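/- Let $q\in\mathbb C\setminus\{0\}$ be not a root of $1$. Let $A(SL_q(2))$ be the unital complex algebra generated by $a,b,c,d$ with relations $$ab=q^{-1}ba,\quad ac=q^{-1}ca,\quad bd=q^{-1}db,\quad bc=cb,\quad cd=q^{-1}dc,$$ $$ad-da=(q^{-1}-q)bc,\quad ad-q^{-1}bc=da-qbc=1,$$ with comultiplication given by $\Delta(a)=a\otimes a+b\otimes c$, $\Delta(b)=a\otimes b+b\otimes d$, $\Delta(c)=c\otimes a+d\otimes c$, $\Delta(d)=c\otimes b+d\otimes d$. Let $\pi:A(SL_q(2))\to\mathbb C[z,z^{-1}]$ be the algebra map with $\pi(a)=z$, $\pi(d)=z^{-1}$, $\pi(b)=\pi(c)=0$, let $\Delta_R=(\mathrm{id}\otimes\pi)\circ\Delta$, and let $A(S_q^2)=\{p\in A(SL_q(2)) : \Delta_R\,p=p\otimes 1\}$ be the coordinate ring of the standard quantum sphere. For $\mu\in\mathbb Z$ let $P_\mu=\{p\in A(SL_q(2)) : \Delta_R\,p=p\otimes z^{-\mu}\}$ be the quantum Hopf line bundle of winding number $\mu$, regarded as a right $A(S_q^2)$-module. Let $\zeta=-q^{-1}bc$,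 and let $\tau^1:A(S_q^2)\to\mathbb C$ be the (unique) linear functional such that, for all integers $m,n\ge 0$, $$\tau^1((ab)^m\zeta^n)=\tau^1((cd)^m\zeta^n)=\begin{cases}(1-q^{2n})^{-1}&\text{if } n>0,\ m=0,\\ 0&\text{otherwise.}\end{cases}$$ For $x\in\mathbb C$ not a root of $1$ write $$\binom{n}{k}_{x}=\frac{(x-1)\cdots(x^n-1)}{(x-1)\cdots(x^k-1)\,(x-1)\cdots(x^{n-k}-1)},$$ and let $f_\mu\in M_{|\mu|+1}(A(S_q^2))$ be the matrix with entries, for $0\le l,k\le|\mu|$ ($l$ the row, $k$ the column), $$(f_\mu)_{lk}=\begin{cases}\binom{-\mu}{l}_{q^2}(-q)^{-l}\,b^l d^{-\mu-l}a^{-\mu-k}c^k&\text{for }\mu\le 0,\\[1mm] \binom{\mu}{l}_{q^2}(-q)^{l}\,a^{\mu-l}c^l b^k d^{\mu-k}&\text{for }\mu\ge 0.\end{cases}$$ Then for every $\mu\in\mathbb Z$ the matrix $f_\mu$ is a projector matrix of the right module $P_\mu$, that is, $f_\mu^2=f_\mu$ and $f_\mu A(S_q^2)^{|\mu|+1}\cong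 P_\mu$ as right $A(S_q^2)$-modules, and the right Chern number of $P_\mu$ is the negative of its winding number: $$(\tau^1\circ\mathrm{Tr})(f_\mu)=-\mu .$$ -/

import Mathlib

open scoped TensorProduct LaurentPolynomial MulOpposite

noncomputable section

set_option linter.unusedSectionVars false

namespace QuantumHopf

/-! ### The algebra `A(SL_q(2))` -/

/-- The defining relations of `A(SL_q(2))`, for four elements of a complex algebra. -/
structure IsSLq {R : Type*} [Ring R] [Algebra ℂ R] (q : ℂ) (a b c d : R) : Prop where
  ab : a * b = q⁻¹ • (b * a)
  ac : a * c = q⁻¹ • (c * a)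
  bd : b * d = q⁻¹ • (d * b)
  bc : b * c = c * b
  cd : c * d = q⁻¹ • (d * c)
  ad_da : a * d - d * a = (q⁻¹ - q) • (b * c)
  ad : a * d - q⁻¹ • (b * c) = 1
  da : d * a - q • (b * c) = 1

/-- Names of the four generators. -/
inductive Gen : Type
  | a | b | c | d

/-- The relations `IsSLq`, imposed on the generators of the free algebra. -/
inductive Rel (q : ℂ) : FreeAlgebra ℂ Gen → FreeAlgebra ℂ Gen → Prop
  | ab : Rel q (.ι ℂ .a * .ι ℂ .b) (q⁻¹ • (.ι ℂ .b * .ι ℂ .a))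
  | ac : Rel q (.ι ℂ .a * .ι ℂ .c) (q⁻¹ • (.ι ℂ .c * .ι ℂ .a))
  | bd : Rel q (.ι ℂ .b * .ι ℂ .d) (q⁻¹ • (.ι ℂ .d * .ι ℂ .b))
  | bc : Rel q (.ι ℂ .b * .ι ℂ .c) (.ι ℂ .c * .ι ℂ .b)
  | cd : Rel q (.ι ℂ .c * .ι ℂ .d) (q⁻¹ • (.ι ℂ .d * .ι ℂ .c))
  | ad_da : Rel q (.ι ℂ .a * .ι ℂ .d - .ι ℂ .d * .ι ℂ .a) ((q⁻¹ - q) • (.ι ℂ .b * .ι ℂ .c))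
  | ad : Rel q (.ι ℂ .a * .ι ℂ .d - q⁻¹ • (.ι ℂ .b * .ι ℂ .c)) 1
  | da : Rel q (.ι ℂ .d * .ι ℂ .a - q • (.ι ℂ .b * .ι ℂ .c)) 1

/-- The complex algebra `A(SL_q(2))`, by generators and relations. -/
def SLq (q : ℂ) : Type := RingQuot (Rel q)

instance (q : ℂ) : Ring (SLq q) := inferInstanceAs (Ring (RingQuot (Rel q)))

instance (q : ℂ) : Algebra ℂ (SLq q) := inferInstanceAs (Algebra ℂ (RingQuot (Rel q)))

namespace SLq

/-- The quotient map from the free algebra. -/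
def mk (q : ℂ) : FreeAlgebra ℂ Gen →ₐ[ℂ] SLq q := RingQuot.mkAlgHom ℂ (Rel q)

/-- The generator `a` -/
def a (q : ℂ) : SLq q := mk q (.ι ℂ .a)

/-- The generator `b` -/
def b (q : ℂ) : SLq q := mk q (.ι ℂ .b)

/-- The generator `c` -/
def c (q : ℂ) : SLq q := mk q (.ι ℂ .c)

/-- The generator `d` -/
def d (q : ℂ) : SLq q := mk q (.ι ℂ .d)

theorem mk_rel {q : ℂ} {x y : FreeAlgebra ℂ Gen} (h : Rel q x y) : mk q x = mk q y :=
  RingQuot.mkAlgHom_rel ℂ h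

theorem isSLq (q : ℂ) : IsSLq q (a q) (b q) (c q) (d q) where
  ab := by simpa [a, b, c, d] using mk_rel (Rel.ab (q := q))
  ac := by simpa [a, b, c, d] using mk_rel (Rel.ac (q := q))
  bd := by simpa [a, b, c, d] using mk_rel (Rel.bd (q := q))
  bc := by simpa [a, b, c, d] using mk_rel (Rel.bc (q := q))
  cd := by simpa [a, b, c, d] using mk_rel (Rel.cd (q := q))
  ad_da := by simpa [a, b, c, d] using mk_rel (Rel.ad_da (q := q))
  ad := by simpa [a, b, c, d] using mk_rel (Rel.ad (q := q))
  da := by simpa [a, b, c, d] using mk_rel (Rel.da (q := q))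

/-- The image in `R` of a generator. -/
def genMap {R : Type*} (x y z w : R) : Gen → R
  | .a => x
  | .b => y
  | .c => z
  | .d => w

/-- The universal property of `A(SL_q(2))`. -/
def lift {q : ℂ} {R : Type*} [Ring R] [Algebra ℂ R] {x y z w : R} (h : IsSLq q x y z w) :
    SLq q →ₐ[ℂ] R :=
  RingQuot.liftAlgHom ℂ ⟨FreeAlgebra.lift ℂ (genMap x y z w), by
    intro u v huv
    cases huv
    · simpa [genMap] using h.ab
    · simpa [genMap] using h.ac
    · simpa [genMap] using h.bd
    · simpa [genMap] using h.bc
    · simpa [genMap] using h.cd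
    · simpa [genMap] using h.ad_da
    · simpa [genMap] using h.ad
    · simpa [genMap] using h.da⟩

section lift

variable {q : ℂ} {R : Type*} [Ring R] [Algebra ℂ R] {x y z w : R} (h : IsSLq q x y z w)

theorem lift_mk (u : FreeAlgebra ℂ Gen) :
    lift h (mk q u) = FreeAlgebra.lift ℂ (genMap x y z w) u :=
  RingQuot.liftAlgHom_mkAlgHom_apply _ _ _ _

@[simp] theorem lift_a : lift h (a q) = x := by simp [a, lift_mk, genMap]
@[simp] theorem lift_b : lift h (b q) = y := by simp [b, lift_mk, genMap]
@[simp] theorem lift_c : lift h (c q) = z := by simp [c, lift_mk, genMap]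
@[simp] theorem lift_d : lift h (d q) = w := by simp [d, lift_mk, genMap]

end lift

section normal

variable (q : ℂ)

theorem ad : a q * d q = 1 + q⁻¹ • (b q * c q) := sub_eq_iff_eq_add.1 (isSLq q).ad
theorem da : d q * a q = 1 + q • (b q * c q) := sub_eq_iff_eq_add.1 (isSLq q).da
theorem cb : c q * b q = b q * c q := (isSLq q).bc.symm
theorem ab : a q * b q = q⁻¹ • (b q * a q) := (isSLq q).ab
theorem ac : a q * c q = q⁻¹ • (c q * a q) := (isSLq q).ac

variable [NeZero q]

theorem db : d q * b q = q • (b q * d q) := by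
  rw [(isSLq q).bd, smul_smul, mul_inv_cancel₀ (NeZero.ne q), one_smul]
theorem dc : d q * c q = q • (c q * d q) := by
  rw [(isSLq q).cd, smul_smul, mul_inv_cancel₀ (NeZero.ne q), one_smul]

end normal

end SLq

open SLq

/-! ### The Hopf fibration and the standard quantum sphere -/

section fibration

variable (q : ℂ) [NeZero q]

theorem isSLq_comul : IsSLq q
    (a q ⊗ₜ[ℂ] a q + b q ⊗ₜ[ℂ] c q) (a q ⊗ₜ[ℂ] b q + b q ⊗ₜ[ℂ] d q)
    (c q ⊗ₜ[ℂ] a q + d q ⊗ₜ[ℂ] c q) (c q ⊗ₜ[ℂ] b q + d q ⊗ₜ[ℂ] d q) := by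
  have hq : q ≠ 0 := NeZero.ne q
  constructor <;>
  · simp only [mul_add, add_mul, Algebra.TensorProduct.tmul_mul_tmul, ab, ac, db, dc, cb, ad, da,
      TensorProduct.add_tmul, TensorProduct.tmul_add, ← TensorProduct.smul_tmul',
      TensorProduct.tmul_smul, Algebra.TensorProduct.one_def]
    match_scalars <;> field_simp <;> ring

/-- The comultiplication of `A(SL_q(2))`. -/
def comul : SLq q →ₐ[ℂ] SLq q ⊗[ℂ] SLq q := lift (isSLq_comul q)

theorem isSLq_proj : IsSLq q (LaurentPolynomial.T 1 : ℂ[T;T⁻¹]) 0 0 (LaurentPolynomial.T (-1)) := by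
  have h : (LaurentPolynomial.T 1 : ℂ[T;T⁻¹]) * LaurentPolynomial.T (-1) = 1 := by
    rw [← LaurentPolynomial.T_add, add_neg_cancel, LaurentPolynomial.T_zero]
  constructor <;> simp [h, mul_comm (LaurentPolynomial.T (-1) : ℂ[T;T⁻¹])]

/-- The surjection `π` onto `ℂ[z, z⁻¹]` (the variable `z` is `T 1`), with `π a = z`, `π d = z⁻¹` and
`π b = π c = 0`. -/
def proj : SLq q →ₐ[ℂ] ℂ[T;T⁻¹] := lift (isSLq_proj q)

/-- The right coaction `Δ_R = (id ⊗ π) ∘ Δ` of `ℂ[z, z⁻¹]` on `A(SL_q(2))`. -/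
def coaction : SLq q →ₐ[ℂ] SLq q ⊗[ℂ] ℂ[T;T⁻¹] :=
  (Algebra.TensorProduct.map (AlgHom.id ℂ (SLq q)) (proj q)).comp (comul q)

@[simp] theorem coaction_a : coaction q (a q) = a q ⊗ₜ LaurentPolynomial.T 1 := by
  simp [coaction, comul, proj]
@[simp] theorem coaction_b : coaction q (b q) = b q ⊗ₜ LaurentPolynomial.T (-1) := by
  simp [coaction, comul, proj]
@[simp] theorem coaction_c : coaction q (c q) = c q ⊗ₜ LaurentPolynomial.T 1 := by
  simp [coaction, comul, proj]
@[simp] theorem coaction_d : coaction q (d q) = d q ⊗ₜ LaurentPolynomial.T (-1) := by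
  simp [coaction, comul, proj]

/-- The coordinate ring `A(S_q²)` of the standard quantum sphere: the coinvariants of `Δ_R`. -/
def sphere : Subalgebra ℂ (SLq q) where
  carrier := {p | coaction q p = p ⊗ₜ 1}
  mul_mem' {x y} hx hy := by
    simp only [Set.mem_ofPred_eq] at hx hy ⊢
    rw [map_mul, hx, hy, Algebra.TensorProduct.tmul_mul_tmul, mul_one]
  add_mem' {x y} hx hy := by
    simp only [Set.mem_ofPred_eq] at hx hy ⊢
    rw [map_add, hx, hy, TensorProduct.add_tmul]
  algebraMap_mem' r := by
    simp only [Set.mem_ofPred_eq]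
    rw [AlgHom.commutes]; rfl

theorem mem_sphere {p : SLq q} : p ∈ sphere q ↔ coaction q p = p ⊗ₜ 1 := Iff.rfl

/-- `A(SL_q(2))` as a right module over `A(S_q²)`, by multiplication on the right. -/
instance : Module (sphere q)ᵐᵒᵖ (SLq q) :=
  Module.compHom (SLq q) (RingHom.op (sphere q).val.toRingHom)

theorem op_smul_def (x : (sphere q)ᵐᵒᵖ) (p : SLq q) : x • p = p * (x.unop : SLq q) := rfl

/-- The quantum Hopf line bundle `P_μ` of winding number `μ`, as a right `A(S_q²)`-module: the
elements `p` with `Δ_R p = p ⊗ z^{-μ}`. (These are the values at `1` of the colinear maps from the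
one-dimensional corepresentation `1 ↦ 1 ⊗ z^{-μ}` to `A(SL_q(2))`.) -/
def lineBundle (μ : ℤ) : Submodule (sphere q)ᵐᵒᵖ (SLq q) where
  carrier := {p | coaction q p = p ⊗ₜ LaurentPolynomial.T (-μ)}
  zero_mem' := by simp
  add_mem' {x y} hx hy := by
    simp only [Set.mem_ofPred_eq] at hx hy ⊢
    rw [map_add, hx, hy, TensorProduct.add_tmul]
  smul_mem' x p hp := by
    simp only [Set.mem_ofPred_eq] at hp ⊢
    rw [op_smul_def, map_mul, hp, (mem_sphere q).1 x.unop.2, Algebra.TensorProduct.tmul_mul_tmul,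
      mul_one]

end fibration

/-! ### The right projector matrices -/

/-- The `x`-binomial coefficient
`(x-1)...(x^n-1) / ((x-1)...(x^k-1) (x-1)...(x^{n-k}-1))`, for `k ≤ n`. -/
def qBinom (x : ℂ) (n k : ℕ) : ℂ :=
  (∏ i ∈ Finset.range n, (x ^ (i + 1) - 1)) /
    ((∏ i ∈ Finset.range k, (x ^ (i + 1) - 1)) * ∏ i ∈ Finset.range (n - k), (x ^ (i + 1) - 1))

/-- The entry `(f_μ)_{lk}`, for `0 ≤ l, k ≤ n = |μ|`. -/
def rightEntry (q : ℂ) (μ : ℤ) (l k : ℕ) : SLq q :=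
  let n := μ.natAbs
  if μ ≤ 0 then
    (qBinom (q ^ 2) n l * (-q) ^ (-(l : ℤ))) •
      (b q ^ l * d q ^ (n - l) * a q ^ (n - k) * c q ^ k)
  else
    (qBinom (q ^ 2) n l * (-q) ^ l) •
      (a q ^ (n - l) * c q ^ l * b q ^ k * d q ^ (n - k))

section projector

variable (q : ℂ) [NeZero q]

theorem rightEntry_mem (μ : ℤ) {l k : ℕ} (hl : l ≤ μ.natAbs) (hk : k ≤ μ.natAbs) :
    rightEntry q μ l k ∈ sphere q := by
  unfold rightEntry
  dsimp only
  split_ifs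
  all_goals
    refine Subalgebra.smul_mem _ ?_ _
    rw [mem_sphere]
    simp only [map_mul, map_pow, coaction_a, coaction_b, coaction_c, coaction_d,
      Algebra.TensorProduct.tmul_pow, Algebra.TensorProduct.tmul_mul_tmul, LaurentPolynomial.T_pow,
      ← LaurentPolynomial.T_add]
    rw [← LaurentPolynomial.T_zero]
    congr 2
    push_cast [Nat.cast_sub hl, Nat.cast_sub hk]
    ring

/-- The matrix `f_μ ∈ M_{|μ|+1}(A(S_q²))`; rows are indexed by `l`, columns by `k`. -/
def rightProjector (μ : ℤ) :
    Matrix (Fin (μ.natAbs + 1)) (Fin (μ.natAbs + 1)) (sphere q) :=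
  Matrix.of fun l k =>
    ⟨rightEntry q μ l k,
      rightEntry_mem q μ (Nat.lt_succ_iff.1 l.is_lt) (Nat.lt_succ_iff.1 k.is_lt)⟩

end projector

/-- The right `B`-module `f Bᴺ`, for a square matrix `f` over a ring `B`. -/
def rightRange {B : Type*} [Ring B] {N : ℕ} (f : Matrix (Fin N) (Fin N) B) :
    Submodule Bᵐᵒᵖ (Fin N → B) where
  carrier := Set.range fun v => f.mulVec v
  zero_mem' := ⟨0, f.mulVec_zero⟩
  add_mem' := by
    rintro _ _ ⟨v, rfl⟩ ⟨w, rfl⟩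
    exact ⟨v + w, f.mulVec_add v w⟩
  smul_mem' := by
    rintro x _ ⟨v, rfl⟩
    exact ⟨x • v, f.mulVec_smul x v⟩

/-! ### The Chern cyclic cocycle -/

/-- `ζ = -q⁻¹ bc` -/
def zeta (q : ℂ) : SLq q := -(q⁻¹ • (b q * c q))

section cocycle

variable (q : ℂ) [NeZero q]

theorem ab_mem : a q * b q ∈ sphere q := by
  simp only [mem_sphere, map_mul, coaction_a, coaction_b, Algebra.TensorProduct.tmul_mul_tmul,
    ← LaurentPolynomial.T_add]
  simp

theorem cd_mem : c q * d q ∈ sphere q := by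
  simp only [mem_sphere, map_mul, coaction_c, coaction_d, Algebra.TensorProduct.tmul_mul_tmul,
    ← LaurentPolynomial.T_add]
  simp

theorem zeta_mem : zeta q ∈ sphere q := by
  refine neg_mem (Subalgebra.smul_mem _ ?_ _)
  simp only [mem_sphere, map_mul, coaction_b, coaction_c, Algebra.TensorProduct.tmul_mul_tmul,
    ← LaurentPolynomial.T_add]
  simp

/-- The element `ab` of `A(S_q²)`. -/
def sphereAB : sphere q := ⟨a q * b q, ab_mem q⟩

/-- The element `cd` of `A(S_q²)`. -/
def sphereCD : sphere q := ⟨c q * d q, cd_mem q⟩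

/-- The element `ζ` of `A(S_q²)`. -/
def sphereZeta : sphere q := ⟨zeta q, zeta_mem q⟩

/-- The formulas that determine the Chern cyclic cocycle `τ¹`. -/
def IsTauOne (τ : sphere q →ₗ[ℂ] ℂ) : Prop :=
  (∀ m n : ℕ, τ (sphereAB q ^ m * sphereZeta q ^ n) =
    if 0 < n ∧ m = 0 then (1 - q ^ (2 * n))⁻¹ else 0) ∧
  (∀ m n : ℕ, τ (sphereCD q ^ m * sphereZeta q ^ n) =
    if 0 < n ∧ m = 0 then (1 - q ^ (2 * n))⁻¹ else 0)

/-! The cocycle exists: `A(SL_q(2))` acts on the vector space with basis `e k l m`, which stands for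
`b^l c^m a^k` if `k ≥ 0` and for `b^l c^m d^{-k}` if `k ≤ 0`, and the value of the cocycle at `x` is
a linear functional of `x • e 0 0 0`. -/

/-- The basis vectors. -/
def e (k : ℤ) (l m : ℕ) : ℤ × ℕ × ℕ →₀ ℂ := Finsupp.single (k, l, m) 1

/-- The linear map with prescribed values on the basis. -/
def ext {W : Type*} [AddCommGroup W] [Module ℂ W] (f : ℤ → ℕ → ℕ → W) :
    (ℤ × ℕ × ℕ →₀ ℂ) →ₗ[ℂ] W :=
  Finsupp.linearCombination ℂ fun i => f i.1 i.2.1 i.2.2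

@[simp] theorem ext_e {W : Type*} [AddCommGroup W] [Module ℂ W] (f : ℤ → ℕ → ℕ → W) (k : ℤ)
    (l m : ℕ) : ext f (e k l m) = f k l m := by
  simp [ext, e]

theorem hom_ext {W : Type*} [AddCommGroup W] [Module ℂ W] {f g : (ℤ × ℕ × ℕ →₀ ℂ) →ₗ[ℂ] W}
    (h : ∀ k l m, f (e k l m) = g (e k l m)) : f = g := by
  refine Finsupp.lhom_ext' fun i => LinearMap.ext_ring ?_
  exact h i.1 i.2.1 i.2.2

/-- Left multiplication by `a` -/
def opA : Module.End ℂ (ℤ × ℕ × ℕ →₀ ℂ) := ext fun k l m =>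
  (q ^ (l + m))⁻¹ • (e (k + 1) l m + (if k < 0 then q⁻¹ else 0) • e (k + 1) (l + 1) (m + 1))

/-- Left multiplication by `b` -/
def opB : Module.End ℂ (ℤ × ℕ × ℕ →₀ ℂ) := ext fun k l m => e k (l + 1) m

/-- Left multiplication by `c` -/
def opC : Module.End ℂ (ℤ × ℕ × ℕ →₀ ℂ) := ext fun k l m => e k l (m + 1)

/-- Left multiplication by `d` -/
def opD : Module.End ℂ (ℤ × ℕ × ℕ →₀ ℂ) := ext fun k l m =>
  q ^ (l + m) • (e (k - 1) l m + (if 0 < k then q else 0) • e (k - 1) (l + 1) (m + 1))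

theorem isSLq_op : IsSLq q (opA q) opB opC (opD q) := by
  have hq : q ≠ 0 := NeZero.ne q
  constructor
  all_goals
    refine hom_ext fun k l m => ?_
    rcases lt_trichotomy k 0 with hk | hk | hk
    all_goals
      simp only [opA, opB, opC, opD, Module.End.mul_apply, LinearMap.sub_apply,
        LinearMap.smul_apply, ext_e, map_add, map_smul, Module.End.one_apply, add_sub_cancel_right,
        sub_add_cancel]
      all_goals first
        | have g1 : ¬ (0 < k) := by omega
          have g2 : ¬ (0 < k + 1) := by omega
          have g3 : k - 1 < 0 := by omega
          simp only [if_pos hk, if_neg g1, if_neg g2, if_pos g3]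
        | have g1 : ¬ (k < 0) := by omega
          have g2 : 0 < k + 1 := by omega
          have g3 : ¬ (k - 1 < 0) := by omega
          simp only [if_pos hk, if_neg g1, if_pos g2, if_neg g3]
        | subst hk
          simp only [lt_self_iff_false, if_false, zero_add, zero_sub, zero_lt_one, if_true,
            neg_lt_zero]
      all_goals match_scalars <;> field_simp <;> try ring

/-- The functional on `A(SL_q(2))` that restricts to the cocycle. -/
def tauAux : SLq q →ₗ[ℂ] ℂ :=
  (ext fun k l m => if k = 0 ∧ l = m ∧ 0 < l then (-q) ^ l * (1 - q ^ (2 * l))⁻¹ else 0) ∘ₗ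
    LinearMap.applyₗ (e 0 0 0) ∘ₗ
      (lift (isSLq_op q)).toLinearMap

theorem op_ab_pow (m : ℕ) : ∀ (k : ℤ) (l n : ℕ), 0 ≤ k →
    ∃ s : ℂ, s ≠ 0 ∧ ((opA q * opB) ^ m) (e k l n) = s • e (k + m) (l + m) n := by
  have hq : q ≠ 0 := NeZero.ne q
  induction m with
  | zero => intro k l n _; exact ⟨1, one_ne_zero, by simp⟩
  | succ m ih =>
    intro k l n hk
    obtain ⟨s, hs, h⟩ := ih (k + 1) (l + 1) n (by omega)
    refine ⟨(q ^ (l + 1 + n))⁻¹ * s, by positivity, ?_⟩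
    have hk' : ¬ k < 0 := by omega
    rw [pow_succ, Module.End.mul_apply, Module.End.mul_apply]
    simp only [opB, opA, ext_e, if_neg hk', zero_smul, add_zero, map_smul] at h ⊢
    rw [h, smul_smul]
    congr 2
    · push_cast; ring
    · ring

theorem op_cd_pow (m : ℕ) : ∀ (k : ℤ) (l n : ℕ), k ≤ 0 →
    ∃ s : ℂ, s ≠ 0 ∧ ((opC * opD q) ^ m) (e k l n) = s • e (k - m) l (n + m) := by
  have hq : q ≠ 0 := NeZero.ne q
  induction m with
  | zero => intro k l n _; exact ⟨1, one_ne_zero, by simp⟩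
  | succ m ih =>
    intro k l n hk
    obtain ⟨s, hs, h⟩ := ih (k - 1) l (n + 1) (by omega)
    refine ⟨q ^ (l + n) * s, by positivity, ?_⟩
    have hk' : ¬ 0 < k := by omega
    rw [pow_succ, Module.End.mul_apply, Module.End.mul_apply]
    simp only [opC, opD, ext_e, if_neg hk', zero_smul, add_zero, map_smul] at h ⊢
    rw [h, smul_smul]
    congr 2
    · push_cast; ring
    · ring

theorem lift_zeta_pow (n : ℕ) :
    lift (isSLq_op q) (zeta q ^ n) (e 0 0 0) = (-q⁻¹) ^ n • e 0 n n := by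
  induction n with
  | zero => simp
  | succ n ih =>
    rw [pow_succ', map_mul, Module.End.mul_apply, ih]
    simp [zeta, opB, opC, smul_smul, pow_succ]

theorem lift_ab_zeta (m n : ℕ) :
    ∃ s : ℂ, s ≠ 0 ∧ lift (isSLq_op q) ((a q * b q) ^ m * zeta q ^ n) (e 0 0 0) =
      s • e m (n + m) n := by
  have hq : q ≠ 0 := NeZero.ne q
  obtain ⟨s, hs, h⟩ := op_ab_pow q m 0 n n le_rfl
  refine ⟨(-q⁻¹) ^ n * s, mul_ne_zero (pow_ne_zero _ (by simpa using hq)) hs, ?_⟩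
  rw [map_mul, Module.End.mul_apply, lift_zeta_pow, map_smul, map_pow, map_mul, lift_a, lift_b, h,
    smul_smul, zero_add]

theorem lift_cd_zeta (m n : ℕ) :
    ∃ s : ℂ, s ≠ 0 ∧ lift (isSLq_op q) ((c q * d q) ^ m * zeta q ^ n) (e 0 0 0) =
      s • e (-m) n (n + m) := by
  have hq : q ≠ 0 := NeZero.ne q
  obtain ⟨s, hs, h⟩ := op_cd_pow q m 0 n n le_rfl
  refine ⟨(-q⁻¹) ^ n * s, mul_ne_zero (pow_ne_zero _ (by simpa using hq)) hs, ?_⟩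
  rw [map_mul, Module.End.mul_apply, lift_zeta_pow, map_smul, map_pow, map_mul, lift_c, lift_d, h,
    smul_smul, zero_sub]

theorem tauAux_zeta_pow (n : ℕ) :
    tauAux q (zeta q ^ n) = if 0 < n then (1 - q ^ (2 * n))⁻¹ else 0 := by
  have hq : q ≠ 0 := NeZero.ne q
  have h : (-q⁻¹) ^ n * (-q) ^ n = 1 := by
    rw [← mul_pow, neg_mul_neg, inv_mul_cancel₀ hq, one_pow]
  simp only [tauAux, LinearMap.comp_apply, AlgHom.toLinearMap_apply, LinearMap.applyₗ_apply_apply,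
    lift_zeta_pow, map_smul, ext_e, true_and, smul_eq_mul]
  split_ifs
  · rw [← mul_assoc, h, one_mul]
  · rw [mul_zero]

theorem exists_isTauOne : IsTauOne q (tauAux q ∘ₗ (sphere q).val.toLinearMap) := by
  constructor
  · intro m n
    change tauAux q ((a q * b q) ^ m * zeta q ^ n) = _
    rcases Nat.eq_zero_or_pos m with rfl | hm
    · simp [tauAux_zeta_pow]
    · obtain ⟨s, -, h⟩ := lift_ab_zeta q m n
      have hm' : m ≠ 0 := hm.ne'
      simp only [tauAux, LinearMap.comp_apply, AlgHom.toLinearMap_apply,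
        LinearMap.applyₗ_apply_apply, h, map_smul, ext_e]
      simp [hm']
  · intro m n
    change tauAux q ((c q * d q) ^ m * zeta q ^ n) = _
    rcases Nat.eq_zero_or_pos m with rfl | hm
    · simp [tauAux_zeta_pow]
    · obtain ⟨s, -, h⟩ := lift_cd_zeta q m n
      have hm' : m ≠ 0 := hm.ne'
      simp only [tauAux, LinearMap.comp_apply, AlgHom.toLinearMap_apply,
        LinearMap.applyₗ_apply_apply, h, map_smul, ext_e]
      simp [hm']

/-! The cocycle is unique: the monomials on which it is prescribed span `A(S_q²)`. -/

/-- `a^k` if `k ≥ 0` and `d^{-k}` if `k ≤ 0` -/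
def wordAD (k : ℤ) : SLq q := if 0 ≤ k then a q ^ k.toNat else d q ^ (-k).toNat

/-- The spanning monomials of `A(SL_q(2))`. -/
def word (k : ℤ) (l m : ℕ) : SLq q := b q ^ l * c q ^ m * wordAD q k

theorem bc_comm : Commute (b q) (c q) := (cb q).symm

theorem a_wordAD (k : ℤ) : a q * wordAD q k =
    wordAD q (k + 1) + (if k < 0 then q⁻¹ else 0) • (b q * c q * wordAD q (k + 1)) := by
  unfold wordAD
  obtain ⟨n, rfl | rfl⟩ : ∃ n : ℕ, k = n ∨ k = -(n + 1) := by
    rcases le_or_gt 0 k with h | h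
    · exact ⟨k.toNat, Or.inl (by omega)⟩
    · exact ⟨(-k - 1).toNat, Or.inr (by omega)⟩
  · have h1 : (0 : ℤ) ≤ n := by omega
    have h2 : (0 : ℤ) ≤ n + 1 := by omega
    have h3 : ((n : ℤ) + 1).toNat = n + 1 := by omega
    have h4 : ¬ (n : ℤ) < 0 := by omega
    rw [if_pos h1, if_pos h2, if_neg h4, h3, Int.toNat_natCast, pow_succ', zero_smul, add_zero]
  · have h1 : ¬ (0 : ℤ) ≤ -(n + 1) := by omega
    have h3 : (-(-((n : ℤ) + 1))).toNat = n + 1 := by omega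
    have h4 : -((n : ℤ) + 1) < 0 := by omega
    have h5 : (if 0 ≤ -((n : ℤ) + 1) + 1 then a q ^ (-((n : ℤ) + 1) + 1).toNat
        else d q ^ (-(-((n : ℤ) + 1) + 1)).toNat) = d q ^ n := by
      split_ifs with h
      · obtain rfl : n = 0 := by omega
        simp
      · congr 1; omega
    rw [if_neg h1, if_pos h4, h5, h3, pow_succ', ← mul_assoc, ad, add_mul, one_mul, smul_mul_assoc]

theorem d_wordAD (k : ℤ) : d q * wordAD q k =
    wordAD q (k - 1) + (if 0 < k then q else 0) • (b q * c q * wordAD q (k - 1)) := by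
  unfold wordAD
  obtain ⟨n, rfl | rfl⟩ : ∃ n : ℕ, k = n + 1 ∨ k = -n := by
    rcases le_or_gt k 0 with h | h
    · exact ⟨(-k).toNat, Or.inr (by omega)⟩
    · exact ⟨(k - 1).toNat, Or.inl (by omega)⟩
  · have h1 : (0 : ℤ) ≤ n := by omega
    have h2 : (0 : ℤ) ≤ n + 1 := by omega
    have h3 : ((n : ℤ) + 1).toNat = n + 1 := by omega
    have h4 : (0 : ℤ) < n + 1 := by omega
    rw [add_sub_cancel_right, if_pos h1, if_pos h2, if_pos h4, h3, Int.toNat_natCast, pow_succ',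
      ← mul_assoc, da, add_mul, one_mul, smul_mul_assoc]
  · have h1 : ¬ (0 : ℤ) ≤ -n - 1 := by omega
    have h3 : (-(-(n : ℤ) - 1)).toNat = n + 1 := by omega
    have h4 : ¬ (0 : ℤ) < -n := by omega
    have h5 : (if 0 ≤ -(n : ℤ) then a q ^ (-(n : ℤ)).toNat
        else d q ^ (-(-(n : ℤ))).toNat) = d q ^ n := by
      split_ifs with h
      · obtain rfl : n = 0 := by omega
        simp
      · congr 1; omega
    rw [h5, if_neg h1, if_neg h4, h3, pow_succ', zero_smul, add_zero]

theorem a_bc (l m : ℕ) : a q * (b q ^ l * c q ^ m) =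
    (q ^ (l + m))⁻¹ • (b q ^ l * c q ^ m * a q) := by
  have hb : ∀ l, a q * b q ^ l = (q ^ l)⁻¹ • (b q ^ l * a q) := by
    intro l
    induction l with
    | zero => simp
    | succ l ih =>
      rw [pow_succ, ← mul_assoc, ih, smul_mul_assoc, mul_assoc, ab, mul_smul_comm, smul_smul,
        ← mul_assoc, pow_succ, mul_inv]
  have hc : ∀ l, a q * c q ^ l = (q ^ l)⁻¹ • (c q ^ l * a q) := by
    intro l
    induction l with
    | zero => simp
    | succ l ih =>
      rw [pow_succ, ← mul_assoc, ih, smul_mul_assoc, mul_assoc, ac, mul_smul_comm, smul_smul,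
        ← mul_assoc, pow_succ, mul_inv]
  rw [← mul_assoc, hb, smul_mul_assoc, mul_assoc, hc, mul_smul_comm, smul_smul, ← mul_assoc,
    pow_add, mul_inv]

theorem d_bc (l m : ℕ) : d q * (b q ^ l * c q ^ m) =
    q ^ (l + m) • (b q ^ l * c q ^ m * d q) := by
  have hb : ∀ l, d q * b q ^ l = q ^ l • (b q ^ l * d q) := by
    intro l
    induction l with
    | zero => simp
    | succ l ih =>
      rw [pow_succ, ← mul_assoc, ih, smul_mul_assoc, mul_assoc, db, mul_smul_comm, smul_smul,
        ← mul_assoc, pow_succ]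
  have hc : ∀ l, d q * c q ^ l = q ^ l • (c q ^ l * d q) := by
    intro l
    induction l with
    | zero => simp
    | succ l ih =>
      rw [pow_succ, ← mul_assoc, ih, smul_mul_assoc, mul_assoc, dc, mul_smul_comm, smul_smul,
        ← mul_assoc, pow_succ]
  rw [← mul_assoc, hb, smul_mul_assoc, mul_assoc, hc, mul_smul_comm, smul_smul, ← mul_assoc,
    pow_add]

theorem word_succ (k : ℤ) (l m : ℕ) :
    word q k (l + 1) (m + 1) = b q ^ l * c q ^ m * (b q * c q * wordAD q k) := by
  rw [word, pow_succ, pow_succ', mul_assoc (b q ^ l), ← mul_assoc (b q) (c q),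
    mul_assoc (b q) (c q), ← pow_succ', ((bc_comm q).pow_right (m + 1)).eq, pow_succ]
  simp only [mul_assoc]
  rw [← mul_assoc (c q) (b q), cb, mul_assoc]

theorem ext_word_lift (x : SLq q) (v : ℤ × ℕ × ℕ →₀ ℂ) :
    ext (word q) (lift (isSLq_op q) x v) = x * ext (word q) v := by
  obtain ⟨u, rfl⟩ : ∃ u, mk q u = x := RingQuot.mkAlgHom_surjective ℂ (Rel q) x
  induction u using FreeAlgebra.induction generalizing v with
  | grade0 r => rw [AlgHom.commutes, AlgHom.commutes]; simp [Algebra.algebraMap_eq_smul_one]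
  | grade1 g =>
    suffices h : ext (word q) ∘ₗ lift (isSLq_op q) (mk q (.ι ℂ g)) =
        LinearMap.mulLeft ℂ (mk q (.ι ℂ g)) ∘ₗ ext (word q) from LinearMap.congr_fun h v
    refine hom_ext fun k l m => ?_
    simp only [LinearMap.comp_apply, LinearMap.mulLeft_apply, ext_e]
    cases g
    · change ext (word q) (lift (isSLq_op q) (a q) _) = a q * _
      rw [lift_a, opA, ext_e, map_smul, map_add, map_smul, ext_e, ext_e, word_succ, word, word,
        ← mul_assoc (a q), a_bc, smul_mul_assoc, mul_assoc _ (a q), a_wordAD, mul_add, mul_smul_comm]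
    · change ext (word q) (lift (isSLq_op q) (b q) _) = b q * _
      rw [lift_b, opB, ext_e, ext_e, word, word, pow_succ']
      simp only [mul_assoc]
    · change ext (word q) (lift (isSLq_op q) (c q) _) = c q * _
      rw [lift_c, opC, ext_e, ext_e, word, word, pow_succ', ← mul_assoc, ← mul_assoc, ← mul_assoc,
        ((bc_comm q).pow_left l).eq]
    · change ext (word q) (lift (isSLq_op q) (d q) _) = d q * _
      rw [lift_d, opD, ext_e, map_smul, map_add, map_smul, ext_e, ext_e, word_succ, word, word,
        ← mul_assoc (d q), d_bc, smul_mul_assoc, mul_assoc _ (d q), d_wordAD, mul_add, mul_smul_comm]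
  | mul x y hx hy => rw [map_mul, map_mul, Module.End.mul_apply, hx, hy, mul_assoc]
  | add x y hx hy =>
    rw [map_add, map_add, LinearMap.add_apply, map_add, hx, hy, add_mul]

theorem ext_word_lift_e (x : SLq q) : ext (word q) (lift (isSLq_op q) x (e 0 0 0)) = x := by
  rw [ext_word_lift, ext_e]
  simp [word, wordAD]

theorem coaction_word (k : ℤ) (l m : ℕ) :
    coaction q (word q k l m) = word q k l m ⊗ₜ LaurentPolynomial.T (k - l + m) := by
  unfold word wordAD
  split_ifs with h
  all_goals
    simp only [map_mul, map_pow, coaction_a, coaction_b, coaction_c, coaction_d,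
      Algebra.TensorProduct.tmul_pow, Algebra.TensorProduct.tmul_mul_tmul, LaurentPolynomial.T_pow,
      ← LaurentPolynomial.T_add]
    congr 2
    omega

/-- The projection of `A(SL_q(2))` onto `A(S_q²)`. -/
def expectation : SLq q →ₗ[ℂ] SLq q :=
  (TensorProduct.rid ℂ (SLq q)).toLinearMap ∘ₗ
    TensorProduct.map LinearMap.id
      (Finsupp.lapply 0 ∘ₗ (AddMonoidAlgebra.coeffLinearEquiv ℂ).toLinearMap) ∘ₗ
    (coaction q).toLinearMap

theorem expectation_of {p : SLq q} {n : ℤ} (hp : coaction q p = p ⊗ₜ LaurentPolynomial.T n) :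
    expectation q p = if n = 0 then p else 0 := by
  simp [expectation, hp]

theorem existsUnique_isTauOne : ∃! τ : sphere q →ₗ[ℂ] ℂ, IsTauOne q τ := by
  refine ⟨_, exists_isTauOne q, fun τ hτ => ?_⟩
  set σ := tauAux q ∘ₗ (sphere q).val.toLinearMap with hσ'
  have hσ : IsTauOne q σ := exists_isTauOne q
  let S : Submodule ℂ (SLq q) := (LinearMap.ker (τ - σ)).map (sphere q).val.toLinearMap
  have hword : ∀ k l m, expectation q (word q k l m) ∈ S := by
    intro k l m
    rw [expectation_of q (coaction_word q k l m)]
    split_ifs with h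
    swap
    · exact S.zero_mem
    rcases le_total 0 k with hk | hk
    · obtain ⟨n, rfl⟩ := Int.eq_ofNat_of_zero_le hk
      obtain rfl : l = m + n := by omega
      obtain ⟨s, hs, hx⟩ := lift_ab_zeta q n m
      have h2 := ext_word_lift_e q ((a q * b q) ^ n * zeta q ^ m)
      rw [hx, map_smul, ext_e] at h2
      have h3 : (a q * b q) ^ n * zeta q ^ m ∈ S :=
        ⟨sphereAB q ^ n * sphereZeta q ^ m, by
          simp only [SetLike.mem_coe, LinearMap.mem_ker, LinearMap.sub_apply]
          rw [hτ.1, hσ.1, sub_self], rfl⟩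
      rw [← h2] at h3
      exact (S.smul_mem_iff hs).1 h3
    · obtain ⟨n, rfl⟩ : ∃ n : ℕ, k = -n := ⟨(-k).toNat, by omega⟩
      obtain rfl : m = l + n := by omega
      obtain ⟨s, hs, hx⟩ := lift_cd_zeta q n l
      have h2 := ext_word_lift_e q ((c q * d q) ^ n * zeta q ^ l)
      rw [hx, map_smul, ext_e] at h2
      have h3 : (c q * d q) ^ n * zeta q ^ l ∈ S :=
        ⟨sphereCD q ^ n * sphereZeta q ^ l, by
          simp only [SetLike.mem_coe, LinearMap.mem_ker, LinearMap.sub_apply]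
          rw [hτ.2, hσ.2, sub_self], rfl⟩
      rw [← h2] at h3
      exact (S.smul_mem_iff hs).1 h3
  have hall : ∀ v, expectation q (ext (word q) v) ∈ S := by
    intro v
    induction v using Finsupp.induction_linear with
    | zero => simp
    | add v w hv hw => rw [map_add, map_add]; exact S.add_mem hv hw
    | single i r =>
      have : (Finsupp.single i r : ℤ × ℕ × ℕ →₀ ℂ) = r • e i.1 i.2.1 i.2.2 := by simp [e]
      rw [this, map_smul, map_smul, ext_e]
      exact S.smul_mem _ (hword _ _ _)
  ext x
  have hx : (x : SLq q) ∈ S := by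
    have h1 := hall (lift (isSLq_op q) (x : SLq q) (e 0 0 0))
    have h2 : coaction q (x : SLq q) = (x : SLq q) ⊗ₜ LaurentPolynomial.T 0 := x.2
    rwa [ext_word_lift_e, expectation_of q h2, if_pos rfl] at h1
  obtain ⟨y, hy, hyx⟩ := hx
  obtain rfl : y = x := Subtype.ext hyx
  exact sub_eq_zero.1 hy

/-- The Chern cyclic cocycle `τ¹ : A(S_q²) → ℂ`: the unique linear functional with
`τ¹((ab)^m ζ^n) = τ¹((cd)^m ζ^n) = (1 - q^{2n})⁻¹` if `n > 0` and `m = 0`, and `0` otherwise. -/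
def tauOne : sphere q →ₗ[ℂ] ℂ := (existsUnique_isTauOne q).choose

theorem isTauOne_tauOne : IsTauOne q (tauOne q) := (existsUnique_isTauOne q).choose_spec.1

end cocycle

end QuantumHopf

end

/-! Write `x = q²` and `n = |μ|`. Each entry of `f_μ` factors as `u_l v_k`, with `v_k` in `P_μ` and
`u_l` in `P_{-μ}`. Once `∑ v_k u_k = 1` is known, `f_μ` is idempotent, and `w ↦ ∑ v_k w_k` and `p ↦
(u_l p)_l` are mutually inverse between the range of `f_μ` and `P_μ` (`idempotent_and_range_equiv`).

Both `∑ v_k u_k` and the trace `∑ u_k v_k` are polynomials in `ζ`, because `a^m d^m` and `d^m a^m`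
are Pochhammer products in `ζ` with bases `x⁻¹` and `x`. They are computed by two identities in a
commutative ring, in which the base is `x` or `x⁻¹` and `z` is `ζ` or `xζ`. The unshifted sum `∑
[n,k] z^k (z; x)_{n-k} = 1` (`sum_gaussBinom_qPoch`) gives the normalization. The shifted one, with
`(xz; x)_{n-k}`, equals `∑_j (1 - x^n)⋯(1 - x^{n-j+1}) z^j` (`sum_gaussBinom_qPoch_shift`) and gives
the trace.

Applying `τ¹` replaces `ζ^j` by `(1 - x^j)⁻¹` for `j > 0` and kills the constant term. The Chern
number is then the sum in `sum_qFalling_div`, whose value is `n`. For `μ > 0` the base is `x⁻¹`, and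
`x^j / (1 - x^j) = -1 / (1 - x^{-j})` supplies the sign. -/

namespace QuantumHopf

open SLq Polynomial

/-! ### Gaussian binomial coefficients -/

/-- The Gaussian binomial coefficients, by the `q`-Pascal rule. -/
def gaussBinom {R : Type*} [CommRing R] (x : R) : ℕ → ℕ → R
  | _, 0 => 1
  | 0, _ + 1 => 0
  | n + 1, k + 1 => gaussBinom x n k + x ^ (k + 1) * gaussBinom x n (k + 1)

/-- The `q`-Pochhammer symbol `(z; x)_m = ∏_{i < m} (1 - x^i z)`. -/
def qPoch {R : Type*} [CommRing R] (x z : R) (m : ℕ) : R :=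
  ∏ i ∈ Finset.range m, (1 - x ^ i * z)

/-- The falling product `∏_{i < j} (1 - x^{n - i})`. -/
def qFalling {R : Type*} [CommRing R] (x : R) (n j : ℕ) : R :=
  ∏ i ∈ Finset.range j, (1 - x ^ (n - i))

section gauss

variable {R : Type*} [CommRing R] (x z : R)

@[simp] theorem gaussBinom_zero_right (n : ℕ) : gaussBinom x n 0 = 1 := by
  cases n <;> rfl

theorem gaussBinom_succ_succ (n k : ℕ) : gaussBinom x (n + 1) (k + 1) =
    gaussBinom x n k + x ^ (k + 1) * gaussBinom x n (k + 1) := rfl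

theorem gaussBinom_eq_zero : ∀ {n k : ℕ}, n < k → gaussBinom x n k = 0
  | 0, _ + 1, _ => rfl
  | n + 1, k + 1, h => by
    rw [gaussBinom_succ_succ, gaussBinom_eq_zero (by omega), gaussBinom_eq_zero (by omega)]
    simp

theorem gaussBinom_self : ∀ n : ℕ, gaussBinom x n n = 1
  | 0 => rfl
  | n + 1 => by
    rw [gaussBinom_succ_succ, gaussBinom_self n, gaussBinom_eq_zero x (Nat.lt_succ_self n)]
    simp

theorem map_gaussBinom {S : Type*} [CommRing S] (f : R →+* S) :
    ∀ n k : ℕ, f (gaussBinom x n k) = gaussBinom (f x) n k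
  | _, 0 => by simp
  | 0, _ + 1 => by simp [gaussBinom]
  | n + 1, k + 1 => by
    simp [gaussBinom_succ_succ, map_gaussBinom f n]

/-- Links the Pascal recursion, which makes sense in any commutative ring, to the quotient formula.
The induction step rests on `(x^{k+1} - 1) + x^{k+1} (x^{m+1} - 1) = x^{k+m+2} - 1`. -/
theorem gaussBinom_mul_prod (k m : ℕ) :
    gaussBinom x (k + m) k * ((∏ i ∈ Finset.range k, (x ^ (i + 1) - 1)) *
      ∏ i ∈ Finset.range m, (x ^ (i + 1) - 1)) = ∏ i ∈ Finset.range (k + m), (x ^ (i + 1) - 1) := by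
  induction k generalizing m with
  | zero => simp
  | succ k ihk =>
    induction m with
    | zero => simp [gaussBinom_self]
    | succ m ihm =>
      have h1 := ihk (m + 1)
      rw [show k + 1 + (m + 1) = k + (m + 1) + 1 by omega, gaussBinom_succ_succ,
        Finset.prod_range_succ _ (k + (m + 1)), ← h1]
      rw [show k + 1 + m = k + (m + 1) by omega, ← h1] at ihm
      rw [Finset.prod_range_succ _ m] at ihm ⊢
      rw [Finset.prod_range_succ _ k] at ihm ⊢
      linear_combination (x ^ (k + 1) * (x ^ (m + 1) - 1)) * ihm

theorem qPoch_succ (m : ℕ) : qPoch x z (m + 1) = qPoch x z m * (1 - x ^ m * z) :=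
  Finset.prod_range_succ _ _

theorem qPoch_succ' (m : ℕ) : qPoch x z (m + 1) = (1 - z) * qPoch x (x * z) m := by
  rw [qPoch, Finset.prod_range_succ', mul_comm]
  simp [qPoch, pow_succ, mul_assoc]

/-- The `q`-Pascal rule summed against an arbitrary `f`; it drives both Pochhammer inductions below.
-/
theorem sum_gaussBinom_succ (f : ℕ → ℕ → R) (n : ℕ) :
    ∑ k ∈ Finset.range (n + 2), gaussBinom x (n + 1) k * f k (n + 1 - k) =
      ∑ k ∈ Finset.range (n + 1), gaussBinom x n k * f (k + 1) (n - k) +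
      ∑ k ∈ Finset.range (n + 1), gaussBinom x n k * (x ^ k * f k (n - k + 1)) := by
  have h : ∑ k ∈ Finset.range (n + 1), gaussBinom x n k * (x ^ k * f k (n - k + 1)) =
      ∑ k ∈ Finset.range (n + 2), gaussBinom x n k * (x ^ k * f k (n + 1 - k)) := by
    rw [Finset.sum_range_succ _ (n + 1), gaussBinom_eq_zero x (Nat.lt_succ_self n), zero_mul,
      add_zero]
    refine Finset.sum_congr rfl fun k hk => ?_
    rw [Nat.sub_add_comm (by simpa [Nat.lt_succ_iff] using hk)]
  rw [h, Finset.sum_range_succ', Finset.sum_range_succ' _ (n + 1), ← add_assoc,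
    ← Finset.sum_add_distrib]
  congr 1
  · refine Finset.sum_congr rfl fun k _ => ?_
    rw [gaussBinom_succ_succ, Nat.add_sub_add_right]
    ring
  · simp

/-- Pascal splits the sum into `z` times the sum at `z` and, since `(z; x)_{m+1} = (1 - z)(xz;
x)_m`, `1 - z` times the sum at `xz`. By induction the total is `z + (1 - z)`, so `z` has to vary.
-/
theorem sum_gaussBinom_qPoch (n : ℕ) (z : R) :
    ∑ k ∈ Finset.range (n + 1), gaussBinom x n k * (z ^ k * qPoch x z (n - k)) = 1 := by
  induction n generalizing z with
  | zero => simp [qPoch]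
  | succ n ih =>
    rw [sum_gaussBinom_succ x (fun k m => z ^ k * qPoch x z m)]
    have h1 : ∑ k ∈ Finset.range (n + 1), gaussBinom x n k * (z ^ (k + 1) * qPoch x z (n - k)) =
        z * 1 := by
      rw [← ih z, Finset.mul_sum]
      exact Finset.sum_congr rfl fun k _ => by ring
    have h2 : ∑ k ∈ Finset.range (n + 1),
        gaussBinom x n k * (x ^ k * (z ^ k * qPoch x z (n - k + 1))) = 1 - z := by
      refine Eq.trans ?_ ((congrArg ((1 - z) * ·) (ih (x * z))).trans (mul_one _))
      rw [Finset.mul_sum]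
      exact Finset.sum_congr rfl fun k _ => by rw [qPoch_succ']; ring
    rw [h1, h2]; ring

theorem qFalling_succ (n j : ℕ) :
    qFalling x n (j + 1) = qFalling x n j * (1 - x ^ (n - j)) := Finset.prod_range_succ _ _

theorem qFalling_succ_succ (n j : ℕ) :
    qFalling x (n + 1) (j + 1) = (1 - x ^ (n + 1)) * qFalling x n j := by
  rw [qFalling, Finset.prod_range_succ', mul_comm]
  simp [qFalling]

/-- The factor `i = n` is `1 - x^0`. Truncated subtraction is therefore harmless, and sums over `j`
may be extended past `n`. -/
theorem qFalling_eq_zero {n j : ℕ} (h : n < j) : qFalling x n j = 0 :=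
  Finset.prod_eq_zero (Finset.mem_range.2 h) (by simp)

theorem qFalling_pascal (n j : ℕ) : qFalling x (n + 1) (j + 1) =
    (1 - x ^ (j + 1)) * qFalling x n j + x ^ (j + 1) * qFalling x n (j + 1) := by
  rcases lt_or_ge n j with h | h
  · simp [qFalling_succ_succ, qFalling_eq_zero x h, qFalling_eq_zero x (Nat.lt_succ_of_lt h)]
  · obtain ⟨m, rfl⟩ := Nat.exists_eq_add_of_le h
    rw [qFalling_succ_succ, qFalling_succ, Nat.add_sub_cancel_left]
    ring

/-- The same splitting gives `z S(z) + (1 - xz) S(xz)`, where `S` is the sum for `n`;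
`qFalling_pascal` is the resulting recursion for the coefficient of `z^{j+1}`. -/
theorem sum_gaussBinom_qPoch_shift (n : ℕ) (z : R) :
    ∑ k ∈ Finset.range (n + 1), gaussBinom x n k * (z ^ k * qPoch x (x * z) (n - k)) =
      ∑ j ∈ Finset.range (n + 1), qFalling x n j * z ^ j := by
  induction n generalizing z with
  | zero => simp [qPoch, qFalling]
  | succ n ih =>
    rw [sum_gaussBinom_succ x (fun k m => z ^ k * qPoch x (x * z) m)]
    have h1 : ∑ k ∈ Finset.range (n + 1),
        gaussBinom x n k * (z ^ (k + 1) * qPoch x (x * z) (n - k)) =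
        ∑ j ∈ Finset.range (n + 1), qFalling x n j * z ^ (j + 1) := by
      simp only [pow_succ', mul_left_comm _ z, mul_assoc z, ← Finset.mul_sum, ih]
    -- The right side includes the vanishing term `j = n + 1`, so that removing `j = 0` later leaves
    -- a sum over the same range as the others.
    have h2 : ∑ k ∈ Finset.range (n + 1),
        gaussBinom x n k * (x ^ k * (z ^ k * qPoch x (x * z) (n - k + 1))) =
        (1 - x * z) * ∑ j ∈ Finset.range (n + 2), qFalling x n j * (x * z) ^ j := by
      rw [Finset.sum_range_succ _ (n + 1), qFalling_eq_zero x (Nat.lt_succ_self n), zero_mul,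
        add_zero, ← ih (x * z), Finset.mul_sum]
      exact Finset.sum_congr rfl fun k _ => by rw [qPoch_succ']; ring
    have h3 : (1 - x * z) * ∑ j ∈ Finset.range (n + 2), qFalling x n j * (x * z) ^ j =
        ∑ j ∈ Finset.range (n + 2), qFalling x n j * (x * z) ^ j -
        ∑ j ∈ Finset.range (n + 1), qFalling x n j * (x * z) ^ (j + 1) := by
      rw [sub_mul, one_mul, Finset.sum_range_succ _ (n + 1),
        qFalling_eq_zero x (Nat.lt_succ_self n), zero_mul, add_zero, Finset.mul_sum]
      congr 1
      exact Finset.sum_congr rfl fun k _ => by ring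
    rw [h1, h2, h3, Finset.sum_range_succ' _ (n + 1), Finset.sum_range_succ' _ (n + 1),
      ← sub_eq_zero]
    have h4 : ∀ A B C D : R, A + (B + C - D) - (A + B - D + C) = 0 := fun A B C D => by ring
    have h5 : ∑ j ∈ Finset.range (n + 1), qFalling x (n + 1) (j + 1) * z ^ (j + 1) =
        ∑ j ∈ Finset.range (n + 1), qFalling x n j * z ^ (j + 1) +
        ∑ j ∈ Finset.range (n + 1), qFalling x n (j + 1) * (x * z) ^ (j + 1) -
        ∑ j ∈ Finset.range (n + 1), qFalling x n j * (x * z) ^ (j + 1) := by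
      rw [← Finset.sum_add_distrib, ← Finset.sum_sub_distrib]
      exact Finset.sum_congr rfl fun j _ => by rw [qFalling_pascal]; ring
    rw [h5]
    simpa [qFalling] using h4 _ _ _ _

/-- The sum telescopes, because `x^{n-j} = 1 - (1 - x^{n-j})`. -/
theorem sum_pow_mul_qFalling (n : ℕ) :
    ∑ j ∈ Finset.range (n + 1), x ^ (n - j) * qFalling x n j = 1 := by
  have h : ∀ j, x ^ (n - j) * qFalling x n j = qFalling x n j - qFalling x n (j + 1) := fun j => by
    rw [qFalling_succ]; ring
  simp only [h]
  rw [Finset.sum_range_sub', qFalling_eq_zero x (Nat.lt_succ_self n)]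
  simp [qFalling]

end gauss

/-- Passing from `n` to `n + 1` changes the term of index `j` by exactly `x^{n-j} qFalling x n j`:
the difference of numerators contains `1 - x^{j+1}`, which cancels the denominator. The increments
add up to `1` by `sum_pow_mul_qFalling`. -/
theorem sum_qFalling_div {K : Type*} [Field K] {x : K} (hx : ∀ n : ℕ, 0 < n → x ^ n ≠ 1) (n : ℕ) :
    ∑ j ∈ Finset.range n, qFalling x n (j + 1) * (1 - x ^ (j + 1))⁻¹ = n := by
  induction n with
  | zero => simp
  | succ n ih =>
    have h : ∑ j ∈ Finset.range (n + 1), qFalling x n (j + 1) * (1 - x ^ (j + 1))⁻¹ = n := by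
      rw [Finset.sum_range_succ, qFalling_eq_zero x (Nat.lt_succ_self n), ih]; simp
    rw [Nat.cast_succ]
    refine Eq.trans ?_ (congrArg₂ (· + ·) h (sum_pow_mul_qFalling x n))
    rw [← Finset.sum_add_distrib]
    refine Finset.sum_congr rfl fun j hj => ?_
    have hj' : (1 : K) - x ^ (j + 1) ≠ 0 := sub_ne_zero.2 (hx _ j.succ_pos).symm
    obtain ⟨m, rfl⟩ := Nat.exists_eq_add_of_le (Nat.lt_succ_iff.1 (Finset.mem_range.1 hj))
    rw [qFalling_succ_succ, qFalling_succ, Nat.add_sub_cancel_left]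
    field_simp
    ring

theorem prod_pow_sub_one_ne_zero {x : ℂ} (hx : ∀ n : ℕ, 0 < n → x ^ n ≠ 1) (n : ℕ) :
    ∏ i ∈ Finset.range n, (x ^ (i + 1) - 1) ≠ 0 :=
  Finset.prod_ne_zero_iff.2 fun i _ => sub_ne_zero.2 (hx _ i.succ_pos)

theorem qBinom_eq_gaussBinom {x : ℂ} (hx : ∀ n : ℕ, 0 < n → x ^ n ≠ 1) {n k : ℕ} (h : k ≤ n) :
    qBinom x n k = gaussBinom x n k := by
  obtain ⟨m, rfl⟩ := Nat.exists_eq_add_of_le h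
  rw [qBinom, Nat.add_sub_cancel_left, ← gaussBinom_mul_prod]
  exact mul_div_cancel_right₀ _
    (mul_ne_zero (prod_pow_sub_one_ne_zero hx _) (prod_pow_sub_one_ne_zero hx _))

/-- Each factor obeys `x^i - 1 = -x^i (x^{-i} - 1)`; in the product formula the signs cancel and the
powers of `x` leave `x^{mk}`. -/
theorem gaussBinom_inv {K : Type*} [Field K] {x : K} (hx0 : x ≠ 0)
    (hx : ∀ n : ℕ, 0 < n → x ^ n ≠ 1) (k m : ℕ) :
    gaussBinom x⁻¹ (k + m) k = (x⁻¹) ^ (m * k) * gaussBinom x (k + m) k := by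
  have hF : ∀ n, ∏ i ∈ Finset.range n, (x ^ (i + 1) - 1) =
      (∏ i ∈ Finset.range n, -x ^ (i + 1)) * ∏ i ∈ Finset.range n, ((x⁻¹) ^ (i + 1) - 1) := by
    intro n
    rw [← Finset.prod_mul_distrib]
    refine Finset.prod_congr rfl fun i _ => ?_
    rw [inv_pow]
    field_simp
    ring
  have hc : ∀ n, ∏ i ∈ Finset.range n, -x ^ (i + 1) ≠ 0 := fun n =>
    Finset.prod_ne_zero_iff.2 fun i _ => neg_ne_zero.2 (pow_ne_zero _ hx0)
  have hx' : ∀ n, ∏ i ∈ Finset.range n, ((x⁻¹) ^ (i + 1) - 1) ≠ 0 := fun n =>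
    Finset.prod_ne_zero_iff.2 fun i _ => sub_ne_zero.2 (by simpa using hx _ i.succ_pos)
  have hadd : ∏ i ∈ Finset.range (k + m), -x ^ (i + 1) =
      (∏ i ∈ Finset.range k, -x ^ (i + 1)) * (x ^ (m * k) * ∏ i ∈ Finset.range m, -x ^ (i + 1)) := by
    rw [Finset.prod_range_add]
    congr 1
    have h : ∀ i, -x ^ (k + i + 1) = x ^ k * -x ^ (i + 1) := fun i => by ring
    simp only [h, Finset.prod_mul_distrib, Finset.prod_const, Finset.card_range, ← pow_mul]
    rw [mul_comm k m]
  have h1 := gaussBinom_mul_prod x k m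
  rw [hF, hF, hF, hadd, ← gaussBinom_mul_prod x⁻¹] at h1
  have h2 : gaussBinom x (k + m) k = x ^ (m * k) * gaussBinom x⁻¹ (k + m) k := by
    refine mul_right_cancel₀ (mul_ne_zero (mul_ne_zero (hc k) (hx' k))
      (mul_ne_zero (hc m) (hx' m))) ?_
    linear_combination h1
  rw [h2, ← mul_assoc, ← mul_pow, inv_mul_cancel₀ hx0, one_pow, one_mul]

/-! ### Idempotents of the form column times row. -/

section rankOne

variable (q : ℂ) [NeZero q]

theorem coaction_of_mem {p : SLq q} {n : ℤ} (hp : p ∈ lineBundle q n) :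
    coaction q p = p ⊗ₜ LaurentPolynomial.T (-n) := hp

/-- A matrix `(u_l v_k)` with `∑ v_k u_k = 1`, where the `v_k` lie in `P_μ` and the `u_l` in
`P_{-μ}`, is idempotent, and its range is isomorphic to `P_μ`. -/
theorem idempotent_and_range_equiv {N : ℕ} (μ : ℤ) (f : Matrix (Fin N) (Fin N) (sphere q))
    (u v : Fin N → SLq q) (hf : ∀ l k, (f l k : SLq q) = u l * v k)
    (hu : ∀ l, u l ∈ lineBundle q (-μ)) (hv : ∀ k, v k ∈ lineBundle q μ)
    (huv : ∑ k, v k * u k = 1) :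
    IsIdempotentElem f ∧
      Nonempty (rightRange f ≃ₗ[(sphere q)ᵐᵒᵖ] lineBundle q μ) := by
  have hidem : IsIdempotentElem f := by
    ext l k
    rw [Matrix.mul_apply, AddSubmonoidClass.coe_finsetSum]
    simp only [Subalgebra.coe_mul, hf]
    have h : ∀ j, u l * v j * (u j * v k) = u l * (v j * u j) * v k := fun j => by
      simp only [mul_assoc]
    simp only [h, ← Finset.sum_mul, ← Finset.mul_sum, huv, mul_one]
  have hmul : ∀ (w : Fin N → sphere q) (l : Fin N),
      (f.mulVec w l : SLq q) = u l * ∑ k, v k * (w k : SLq q) := by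
    intro w l
    rw [Matrix.mulVec, dotProduct, AddSubmonoidClass.coe_finsetSum, Finset.mul_sum]
    simp only [Subalgebra.coe_mul, hf, mul_assoc]
  have hmem : ∀ (p : lineBundle q μ) (l : Fin N), u l * (p : SLq q) ∈ sphere q := by
    intro p l
    rw [mem_sphere, map_mul, coaction_of_mem q (hu l), coaction_of_mem q p.2,
      Algebra.TensorProduct.tmul_mul_tmul, ← LaurentPolynomial.T_add]
    simp
  -- `F` pairs with the row `v` and `G` multiplies by the column `u`. Then `F ∘ G = id` by `huv`,
  -- while `G ∘ F` is multiplication by `f`.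
  let F : (Fin N → sphere q) →ₗ[(sphere q)ᵐᵒᵖ] lineBundle q μ :=
    { toFun := fun w => ∑ k, MulOpposite.op (w k) • ⟨v k, hv k⟩
      map_add' := fun w w' => by
        simp only [Pi.add_apply, MulOpposite.op_add, add_smul, Finset.sum_add_distrib]
      map_smul' := fun x w => by
        rw [RingHom.id_apply, Finset.smul_sum]
        refine Finset.sum_congr rfl fun k _ => ?_
        rw [smul_smul]; rfl }
  have hF : ∀ w, (F w : SLq q) = ∑ k, v k * (w k : SLq q) := by
    intro w
    change ((∑ k, MulOpposite.op (w k) • (⟨v k, hv k⟩ : lineBundle q μ) : lineBundle q μ) : SLq q)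
      = _
    rw [AddSubmonoidClass.coe_finsetSum]
    rfl
  let G : lineBundle q μ → (Fin N → sphere q) := fun p l => ⟨u l * (p : SLq q), hmem p l⟩
  have hFG : ∀ p, F (G p) = p := by
    intro p
    apply Subtype.ext
    rw [hF]
    simp only [G, ← mul_assoc, ← Finset.sum_mul, huv, one_mul]
  have hGF : ∀ w, G (F w) = f.mulVec w := by
    intro w
    funext l
    apply Subtype.ext
    rw [hmul, ← hF]
  have hfix : ∀ w ∈ rightRange f, f.mulVec w = w := by
    rintro _ ⟨w, rfl⟩
    change f.mulVec (f.mulVec w) = f.mulVec w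
    rw [Matrix.mulVec_mulVec, hidem.eq]
  refine ⟨hidem, ⟨LinearEquiv.ofBijective (F ∘ₗ (rightRange f).subtype) ⟨?_, ?_⟩⟩⟩
  · intro w w' h
    apply Subtype.ext
    have h' : F w = F w' := h
    rw [← hfix w w.2, ← hfix w' w'.2, ← hGF, ← hGF, h']
  · intro p
    -- `G p` lies in the range because it is fixed by `f`: `f (G p) = G (F (G p)) = G p`.
    exact ⟨⟨G p, G p, (hGF (G p)).symm.trans (by rw [hFG])⟩, hFG p⟩

end rankOne

/-! ### Monomials of the algebra as polynomials in `ζ`. -/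

section monomials

theorem zeta_eq_smul (q : ℂ) : zeta q = (-q)⁻¹ • (b q * c q) := by
  rw [zeta, inv_neg, neg_smul]

theorem a_mul_d (q : ℂ) : a q * d q = 1 - zeta q := by
  rw [ad, zeta, sub_neg_eq_add]

variable (q : ℂ) [NeZero q]

theorem zeta_pow (k : ℕ) : zeta q ^ k = ((-q) ^ k)⁻¹ • (b q ^ k * c q ^ k) := by
  rw [zeta_eq_smul, _root_.smul_pow, (bc_comm q).mul_pow, inv_pow]

theorem a_pow_zeta_pow (m k : ℕ) :
    a q ^ m * zeta q ^ k = ((q ^ 2)⁻¹) ^ (m * k) • (zeta q ^ k * a q ^ m) := by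
  induction m with
  | zero => simp
  | succ m ih =>
    have h : a q * zeta q ^ k = ((q ^ 2)⁻¹) ^ k • (zeta q ^ k * a q) := by
      rw [zeta_pow, mul_smul_comm, a_bc, smul_comm, smul_mul_assoc, inv_pow, ← pow_mul, two_mul]
    rw [pow_succ, mul_assoc, h, mul_smul_comm, ← mul_assoc, ih, smul_mul_assoc, smul_smul,
      mul_assoc, ← pow_succ, ← pow_add]
    congr 2
    ring

theorem d_pow_zeta_pow (m k : ℕ) :
    d q ^ m * zeta q ^ k = (q ^ 2) ^ (m * k) • (zeta q ^ k * d q ^ m) := by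
  induction m with
  | zero => simp
  | succ m ih =>
    have h : d q * zeta q ^ k = (q ^ 2) ^ k • (zeta q ^ k * d q) := by
      rw [zeta_pow, mul_smul_comm, d_bc, smul_comm, smul_mul_assoc, ← pow_mul, two_mul]
    rw [pow_succ, mul_assoc, h, mul_smul_comm, ← mul_assoc, ih, smul_mul_assoc, smul_smul,
      mul_assoc, ← pow_succ, ← pow_add]
    congr 2
    ring

theorem d_mul_a : d q * a q = 1 - (q ^ 2) • zeta q := by
  have hq : q ≠ 0 := NeZero.ne q
  rw [da, zeta, smul_neg, sub_neg_eq_add, smul_smul]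
  congr 2
  field_simp

/-- The innermost `ad` is `1 - ζ`, and carrying `ζ` to the left past `a^m` multiplies it by
`x^{-m}`. Writing the result through `aeval` moves later computations into the commutative ring
`ℂ[X]`. -/
theorem a_pow_mul_d_pow (m : ℕ) :
    a q ^ m * d q ^ m = aeval (zeta q) (qPoch (C (q ^ 2)⁻¹) X m) := by
  induction m with
  | zero => simp [qPoch]
  | succ m ih =>
    have h : a q ^ (m + 1) * d q ^ (m + 1) = (1 - ((q ^ 2)⁻¹) ^ m • zeta q) * (a q ^ m * d q ^ m) := by
      have h1 := a_pow_zeta_pow q m 1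
      rw [pow_one, mul_one] at h1
      rw [pow_succ, pow_succ', mul_assoc, ← mul_assoc (a q), a_mul_d, sub_mul, one_mul, mul_sub,
        ← mul_assoc _ (zeta q), h1, sub_mul, one_mul, smul_mul_assoc, smul_mul_assoc, mul_assoc]
    rw [h, ih, qPoch_succ, mul_comm, map_mul]
    congr 1
    simp [← C_pow, Algebra.smul_def]

/-- Here the innermost `da` is `1 - xζ`, whence the shifted argument, and passing `d^m` contributes
`x^m`. -/
theorem d_pow_mul_a_pow (m : ℕ) :
    d q ^ m * a q ^ m = aeval (zeta q) (qPoch (C (q ^ 2)) (C (q ^ 2) * X) m) := by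
  induction m with
  | zero => simp [qPoch]
  | succ m ih =>
    have h : d q ^ (m + 1) * a q ^ (m + 1) = (1 - (q ^ 2) ^ (m + 1) • zeta q) * (d q ^ m * a q ^ m) := by
      have h1 := d_pow_zeta_pow q m 1
      rw [pow_one, mul_one] at h1
      rw [pow_succ, pow_succ', mul_assoc, ← mul_assoc (d q), d_mul_a, sub_mul, one_mul, mul_sub,
        smul_mul_assoc, mul_smul_comm, ← mul_assoc _ (zeta q), h1, sub_mul, one_mul, smul_mul_assoc,
        smul_mul_assoc, mul_assoc, smul_smul, ← pow_succ']
    rw [h, ih, qPoch_succ, mul_comm (qPoch _ _ m), map_mul]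
    congr 1
    simp [Algebra.smul_def, pow_succ, mul_assoc]

theorem commute_b_zeta : Commute (b q) (zeta q) := by
  rw [zeta_eq_smul]
  exact ((Commute.refl _).mul_right (bc_comm q)).smul_right _

theorem commute_b_pow_aeval_zeta (k : ℕ) (f : ℂ[X]) : Commute (b q ^ k) (aeval (zeta q) f) := by
  refine Commute.pow_left ?_ k
  induction f using Polynomial.induction_on' with
  | add f g hf hg => rw [map_add]; exact hf.add_right hg
  | monomial n r =>
    rw [aeval_monomial]
    exact (Algebra.commute_algebraMap_right r (b q)).mul_right ((commute_b_zeta q).pow_right n)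

theorem a_c_b_d (k m : ℕ) : ((-q) ^ k)⁻¹ • (a q ^ m * c q ^ k * b q ^ k * d q ^ m) =
    aeval (zeta q) (C (((q ^ 2)⁻¹) ^ (m * k)) * (X ^ k * qPoch (C (q ^ 2)⁻¹) X m)) := by
  rw [mul_assoc (a q ^ m), ((bc_comm q).pow_pow k k).symm.eq, ← smul_mul_assoc, ← mul_smul_comm,
    ← zeta_pow, a_pow_zeta_pow, smul_mul_assoc, mul_assoc, a_pow_mul_d_pow]
  simp [Algebra.smul_def]

theorem b_d_a_c (k m : ℕ) : ((-q) ^ k)⁻¹ • (b q ^ k * d q ^ m * a q ^ m * c q ^ k) =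
    aeval (zeta q) (X ^ k * qPoch (C (q ^ 2)) (C (q ^ 2) * X) m) := by
  rw [mul_assoc (b q ^ k), d_pow_mul_a_pow, (commute_b_pow_aeval_zeta q k _).eq, mul_assoc,
    ← mul_smul_comm, ← zeta_pow, mul_comm (X ^ k), map_mul _ _ (X ^ k), map_pow (aeval _) X,
    aeval_X]

end monomials

/-! ### Normalization sums, traces, and the cocycle on polynomials in `ζ`. -/

section sums

variable (q : ℂ) [NeZero q]

/-- The coefficients for `μ > 0` carry `(-q)^k` where those for `μ ≤ 0` carry `(-q)^{-k}`; the
discrepancy `x^k` is absorbed by taking `z = xζ` instead of `z = ζ`. -/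
theorem neg_pow_eq (k : ℕ) : (-q) ^ k = (q ^ 2) ^ k * ((-q) ^ k)⁻¹ := by
  have hq : -q ≠ 0 := neg_ne_zero.2 (NeZero.ne q)
  rw [eq_mul_inv_iff_mul_eq₀ (pow_ne_zero _ hq), ← mul_pow]
  ring

theorem sq_pow_ne_one {q : ℂ} (hq : ∀ n : ℕ, 0 < n → q ^ n ≠ 1) (n : ℕ) (hn : 0 < n) :
    (q ^ 2) ^ n ≠ 1 := by
  rw [← pow_mul]
  exact hq _ (by omega)

theorem C_gaussBinom (x : ℂ) (n k : ℕ) : C (gaussBinom x n k) = gaussBinom (C x) n k :=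
  map_gaussBinom x C n k

theorem C_qFalling (x : ℂ) (n j : ℕ) : C (qFalling x n j) = qFalling (C x) n j := by
  simp [qFalling, map_prod]

theorem sum_b_d_a_c (n : ℕ) :
    ∑ k ∈ Finset.range (n + 1), (gaussBinom (q ^ 2) n k * ((-q) ^ k)⁻¹) •
      (b q ^ k * d q ^ (n - k) * a q ^ (n - k) * c q ^ k) =
    aeval (zeta q) (∑ j ∈ Finset.range (n + 1), C (qFalling (q ^ 2) n j) * X ^ j) := by
  simp only [C_qFalling, ← sum_gaussBinom_qPoch_shift, map_sum]
  refine Finset.sum_congr rfl fun k _ => ?_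
  rw [mul_smul, b_d_a_c, ← C_gaussBinom, map_mul _ (C _), aeval_C, Algebra.smul_def]

/-- With `z = xζ`, the product `d^m a^m` is the unshifted Pochhammer symbol of `z`. -/
theorem sum_b_d_a_c_eq_one (n : ℕ) :
    ∑ k ∈ Finset.range (n + 1), (gaussBinom (q ^ 2) n k * (-q) ^ k) •
      (b q ^ k * d q ^ (n - k) * a q ^ (n - k) * c q ^ k) = 1 := by
  rw [← map_one (aeval (R := ℂ) (zeta q)), ← sum_gaussBinom_qPoch (C (q ^ 2)) n (C (q ^ 2) * X), map_sum]
  refine Finset.sum_congr rfl fun k _ => ?_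
  rw [neg_pow_eq, mul_smul, mul_smul, b_d_a_c, ← C_gaussBinom, mul_pow, mul_assoc (C _ ^ k),
    map_mul _ (C _), map_mul _ (C _ ^ k), ← C_pow, aeval_C, aeval_C, Algebra.smul_def,
    Algebra.smul_def]

/-- The factor `x^{-(n-k)k}` from moving `ζ^k` past `a^{n-k}` is precisely what turns the binomial
in base `x` into the one in base `x⁻¹`, the base of `a^m d^m`. -/
theorem gaussBinom_smul_a_c_b_d (hq : ∀ n : ℕ, 0 < n → q ^ n ≠ 1) {n k : ℕ} (hk : k ≤ n) :
    (gaussBinom (q ^ 2) n k * ((-q) ^ k)⁻¹) •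
      (a q ^ (n - k) * c q ^ k * b q ^ k * d q ^ (n - k)) =
    aeval (zeta q) (gaussBinom (C (q ^ 2)⁻¹) n k * (X ^ k * qPoch (C (q ^ 2)⁻¹) X (n - k))) := by
  have h := gaussBinom_inv (pow_ne_zero 2 (NeZero.ne q)) (sq_pow_ne_one hq) k (n - k)
  rw [Nat.add_sub_cancel' hk] at h
  rw [← C_gaussBinom, h, mul_smul, a_c_b_d, C_mul, mul_comm (C _) (C _), mul_assoc,
    map_mul _ (C (gaussBinom _ _ _)), aeval_C, Algebra.smul_def]

theorem sum_a_c_b_d_eq_one (hq : ∀ n : ℕ, 0 < n → q ^ n ≠ 1) (n : ℕ) :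
    ∑ k ∈ Finset.range (n + 1), (gaussBinom (q ^ 2) n k * ((-q) ^ k)⁻¹) •
      (a q ^ (n - k) * c q ^ k * b q ^ k * d q ^ (n - k)) = 1 := by
  rw [← map_one (aeval (R := ℂ) (zeta q)), ← sum_gaussBinom_qPoch (C (q ^ 2)⁻¹) n X, map_sum]
  refine Finset.sum_congr rfl fun k hk => ?_
  rw [gaussBinom_smul_a_c_b_d q hq (Nat.lt_succ_iff.1 (Finset.mem_range.1 hk))]

/-- The shifted identity in base `x⁻¹` at `z = xζ`, whose shifted argument `x⁻¹ z` is `ζ`. -/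
theorem sum_a_c_b_d (hq : ∀ n : ℕ, 0 < n → q ^ n ≠ 1) (n : ℕ) :
    ∑ k ∈ Finset.range (n + 1), (gaussBinom (q ^ 2) n k * (-q) ^ k) •
      (a q ^ (n - k) * c q ^ k * b q ^ k * d q ^ (n - k)) =
    aeval (zeta q) (∑ j ∈ Finset.range (n + 1),
      C (qFalling (q ^ 2)⁻¹ n j * (q ^ 2) ^ j) * X ^ j) := by
  have hX : C (q ^ 2)⁻¹ * (C (q ^ 2) * X) = (X : ℂ[X]) := by
    rw [← mul_assoc, ← C_mul, inv_mul_cancel₀ (pow_ne_zero 2 (NeZero.ne q)), C_1, one_mul]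
  have h := sum_gaussBinom_qPoch_shift (C (q ^ 2)⁻¹) n (C (q ^ 2) * X)
  rw [hX] at h
  have hr : ∑ j ∈ Finset.range (n + 1), C (qFalling (q ^ 2)⁻¹ n j * (q ^ 2) ^ j) * X ^ j =
      ∑ j ∈ Finset.range (n + 1), qFalling (C (q ^ 2)⁻¹) n j * (C (q ^ 2) * X) ^ j :=
    Finset.sum_congr rfl fun j _ => by
      rw [C_mul, C_qFalling, C_pow (a := q ^ 2), mul_assoc, ← mul_pow]
  rw [hr, ← h, map_sum]
  refine Finset.sum_congr rfl fun k hk => ?_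
  rw [neg_pow_eq, mul_left_comm, mul_smul, gaussBinom_smul_a_c_b_d q hq
    (Nat.lt_succ_iff.1 (Finset.mem_range.1 hk)), mul_pow, mul_assoc (C _ ^ k), mul_left_comm _ (C _ ^ k),
    map_mul _ (C _ ^ k), ← C_pow, aeval_C, Algebra.smul_def]

theorem tauOne_of_coe_eq_aeval_zeta (n : ℕ) (r : ℕ → ℂ) (t : sphere q)
    (ht : (t : SLq q) = aeval (zeta q) (∑ j ∈ Finset.range (n + 1), C (r j) * X ^ j)) :
    tauOne q t = ∑ j ∈ Finset.range n, r (j + 1) * (1 - (q ^ 2) ^ (j + 1))⁻¹ := by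
  have h : t = ∑ j ∈ Finset.range (n + 1), r j • sphereZeta q ^ j := by
    apply Subtype.ext
    rw [ht, AddSubmonoidClass.coe_finsetSum, map_sum]
    refine Finset.sum_congr rfl fun j _ => ?_
    rw [map_mul, aeval_C, map_pow, aeval_X, ← Algebra.smul_def]
    rfl
  have hτ : ∀ j, tauOne q (sphereZeta q ^ j) = if 0 < j then (1 - (q ^ 2) ^ j)⁻¹ else 0 := by
    intro j
    simpa [← pow_mul] using (isTauOne_tauOne q).1 0 j
  simp only [h, map_sum, map_smul, hτ, smul_eq_mul]
  rw [Finset.sum_range_succ']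
  simp

end sums

/-! ### Winding numbers of the factors and the two sign cases. -/

section projector

variable (q : ℂ) [NeZero q]

theorem mem_lineBundle_iff {p : SLq q} {n : ℤ} :
    p ∈ lineBundle q n ↔ coaction q p = p ⊗ₜ LaurentPolynomial.T (-n) := Iff.rfl

theorem smul_mem_lineBundle (r : ℂ) {p : SLq q} {n : ℤ} (hp : p ∈ lineBundle q n) :
    r • p ∈ lineBundle q n := by
  rw [mem_lineBundle_iff] at hp ⊢
  rw [map_smul, hp, TensorProduct.smul_tmul']

theorem a_pow_mul_c_pow_mem {m k : ℕ} {μ : ℤ} (h : (m + k : ℤ) = -μ) :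
    a q ^ m * c q ^ k ∈ lineBundle q μ := by
  simp only [mem_lineBundle_iff, map_mul, map_pow, coaction_a, coaction_c,
    Algebra.TensorProduct.tmul_pow, Algebra.TensorProduct.tmul_mul_tmul, LaurentPolynomial.T_pow,
    ← LaurentPolynomial.T_add]
  congr 2
  omega

theorem b_pow_mul_d_pow_mem {m k : ℕ} {μ : ℤ} (h : (m + k : ℤ) = μ) :
    b q ^ m * d q ^ k ∈ lineBundle q μ := by
  simp only [mem_lineBundle_iff, map_mul, map_pow, coaction_b, coaction_d,
    Algebra.TensorProduct.tmul_pow, Algebra.TensorProduct.tmul_mul_tmul, LaurentPolynomial.T_pow,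
    ← LaurentPolynomial.T_add]
  congr 2
  omega

theorem coe_trace_rightProjector (μ : ℤ) : ((rightProjector q μ).trace : SLq q) =
    ∑ k ∈ Finset.range (μ.natAbs + 1), rightEntry q μ k k := by
  rw [Matrix.trace, AddSubmonoidClass.coe_finsetSum, Finset.sum_range]
  rfl

theorem rightProjector_spec_of_nonpos (hq : ∀ n : ℕ, 0 < n → q ^ n ≠ 1) {μ : ℤ} (hμ : μ ≤ 0) :
    IsIdempotentElem (rightProjector q μ) ∧
    Nonempty (rightRange (rightProjector q μ) ≃ₗ[(sphere q)ᵐᵒᵖ] lineBundle q μ) ∧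
    tauOne q (rightProjector q μ).trace = -(μ : ℂ) := by
  obtain ⟨n, hn⟩ : ∃ n, μ.natAbs = n := ⟨_, rfl⟩
  have hμn : μ = -(n : ℤ) := by omega
  have hentry : ∀ l k, l ≤ n → rightEntry q μ l k =
      ((gaussBinom (q ^ 2) n l * ((-q) ^ l)⁻¹) • (b q ^ l * d q ^ (n - l))) *
        (a q ^ (n - k) * c q ^ k) := by
    intro l k hl
    simp only [rightEntry, if_pos hμ, hn]
    rw [qBinom_eq_gaussBinom (sq_pow_ne_one hq) hl, zpow_neg, zpow_natCast, smul_mul_assoc]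
    simp only [mul_assoc]
  refine and_assoc.1 ⟨idempotent_and_range_equiv q μ (rightProjector q μ)
    (fun l => (gaussBinom (q ^ 2) n l * ((-q) ^ (l : ℕ))⁻¹) • (b q ^ (l : ℕ) * d q ^ (n - l)))
    (fun k => a q ^ (n - k) * c q ^ (k : ℕ)) ?_ ?_ ?_ ?_, ?_⟩
  · exact fun l k => hentry l k (by omega)
  · exact fun l => smul_mem_lineBundle q _ (b_pow_mul_d_pow_mem q (by omega))
  · exact fun k => a_pow_mul_c_pow_mem q (by omega)
  · rw [Finset.sum_fin_eq_sum_range, ← sum_a_c_b_d_eq_one q hq n, hn]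
    refine Finset.sum_congr rfl fun k hk => ?_
    rw [dif_pos (Finset.mem_range.1 hk), mul_smul_comm]
    simp only [mul_assoc]
  · rw [tauOne_of_coe_eq_aeval_zeta q n (qFalling (q ^ 2) n), sum_qFalling_div (sq_pow_ne_one hq),
      hμn]
    · simp
    rw [coe_trace_rightProjector, hn, ← sum_b_d_a_c]
    refine Finset.sum_congr rfl fun k hk => ?_
    rw [hentry k k (Nat.lt_succ_iff.1 (Finset.mem_range.1 hk)), smul_mul_assoc]
    simp only [mul_assoc]

theorem rightProjector_spec_of_pos (hq : ∀ n : ℕ, 0 < n → q ^ n ≠ 1) {μ : ℤ} (hμ : 0 < μ) :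
    IsIdempotentElem (rightProjector q μ) ∧
    Nonempty (rightRange (rightProjector q μ) ≃ₗ[(sphere q)ᵐᵒᵖ] lineBundle q μ) ∧
    tauOne q (rightProjector q μ).trace = -(μ : ℂ) := by
  obtain ⟨n, hn⟩ : ∃ n, μ.natAbs = n := ⟨_, rfl⟩
  have hμn : μ = (n : ℤ) := by omega
  have hentry : ∀ l k, l ≤ n → rightEntry q μ l k =
      ((gaussBinom (q ^ 2) n l * (-q) ^ l) • (a q ^ (n - l) * c q ^ l)) *
        (b q ^ k * d q ^ (n - k)) := by
    intro l k hl
    simp only [rightEntry, if_neg (not_le.2 hμ), hn]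
    rw [qBinom_eq_gaussBinom (sq_pow_ne_one hq) hl, smul_mul_assoc]
    simp only [mul_assoc]
  refine and_assoc.1 ⟨idempotent_and_range_equiv q μ (rightProjector q μ)
    (fun l => (gaussBinom (q ^ 2) n l * (-q) ^ (l : ℕ)) • (a q ^ (n - l) * c q ^ (l : ℕ)))
    (fun k => b q ^ (k : ℕ) * d q ^ (n - k)) ?_ ?_ ?_ ?_, ?_⟩
  · exact fun l k => hentry l k (by omega)
  · exact fun l => smul_mem_lineBundle q _ (a_pow_mul_c_pow_mem q (by omega))
  · exact fun k => b_pow_mul_d_pow_mem q (by omega)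
  · rw [Finset.sum_fin_eq_sum_range, ← sum_b_d_a_c_eq_one q n, hn]
    refine Finset.sum_congr rfl fun k hk => ?_
    rw [dif_pos (Finset.mem_range.1 hk), mul_smul_comm]
    simp only [mul_assoc]
  · have hx := sq_pow_ne_one hq
    have hx0 : q ^ 2 ≠ 0 := pow_ne_zero 2 (NeZero.ne q)
    have hp : ∀ m : ℕ, 0 < m → ((q ^ 2)⁻¹) ^ m ≠ 1 := fun m hm => by simpa using hx m hm
    rw [tauOne_of_coe_eq_aeval_zeta q n fun j => qFalling (q ^ 2)⁻¹ n j * (q ^ 2) ^ j]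
    · have hμ' : (μ : ℂ) = n := by rw [hμn]; simp
      rw [hμ', ← sum_qFalling_div hp n, ← Finset.sum_neg_distrib]
      refine Finset.sum_congr rfl fun j _ => ?_
      have h1 := pow_ne_zero (j + 1) hx0
      have h2 : 1 - (q ^ 2) ^ (j + 1) ≠ 0 := sub_ne_zero.2 (hx _ j.succ_pos).symm
      have h3 : 1 - ((q ^ 2)⁻¹) ^ (j + 1) ≠ 0 := sub_ne_zero.2 (hp _ j.succ_pos).symm
      -- This conversion from base `x` to base `x⁻¹` produces the minus sign of the Chern number.
      have h4 : (q ^ 2) ^ (j + 1) * (1 - (q ^ 2) ^ (j + 1))⁻¹ =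
          -(1 - ((q ^ 2)⁻¹) ^ (j + 1))⁻¹ := by
        rw [← div_eq_mul_inv, div_eq_iff h2, ← mul_right_inj' h3, neg_mul, mul_neg,
          mul_inv_cancel_left₀ h3, sub_mul, inv_pow, inv_mul_cancel₀ h1]
        ring
      rw [mul_assoc, h4, mul_neg]
    · rw [coe_trace_rightProjector, hn, ← sum_a_c_b_d q hq]
      refine Finset.sum_congr rfl fun k hk => ?_
      rw [hentry k k (Nat.lt_succ_iff.1 (Finset.mem_range.1 hk)), smul_mul_assoc]
      simp only [mul_assoc]

end projector

end QuantumHopf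

theorem corollary2p3 (q : ℂ) [NeZero q] (hq : ∀ n : ℕ, 0 < n → q ^ n ≠ 1) (μ : ℤ) :
    IsIdempotentElem (QuantumHopf.rightProjector q μ) ∧
    Nonempty (QuantumHopf.rightRange (QuantumHopf.rightProjector q μ)
      ≃ₗ[(QuantumHopf.sphere q)ᵐᵒᵖ] QuantumHopf.lineBundle q μ) ∧
    QuantumHopf.tauOne q (QuantumHopf.rightProjector q μ).trace = -(μ : ℂ) := by
  rcases le_or_gt μ 0 with hμ | hμ
  · exact QuantumHopf.rightProjector_spec_of_nonpos q hq hμ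
  · exact QuantumHopf.rightProjector_spec_of_pos q hq hμ
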